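/- All graphs are finite, simple, connected and have at least two vertices. For vertices $u,v$ of a graph $G$, a $u$-$v$ geodesic is a $u$-$v$ path whose length is the distance between $u$ and $v$. Let $src(G)$ be the minimum number of colours in a colouring of the edges of $G$ such that any two vertices are joined by a geodesic whose edges have distinct colours. Let $srvc(G)$ be the minimum number of colours in a colouring of the vertices of $G$ such that any two vertices are joined by a geodesic whose internal vertices have distinct colours, with the convention $srvc(G)=0$ if $G$ is complete. Let $strc(G)$ be the minimum number of colours in a colouring of the vertices and edges of $G$ such that any two vertices are joined by a geodesic whose edges and internal vertices all have distinct colours. (a) There exist infinitely many pairwise non-isomorphic graphs $G$ with $strc(G)=src(G)=3$. (b) For every integer $s\ge 13$ there exists a graph $G$ with $strc(G)=srvc(G)=s$. (c) For all integers $1\le t<s$ there exists a graph $G$ with $strc(G)\ge s$ and $srvc(G)=t$. -/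

import Mathlib

namespace SimpleGraph

variable {V : Type*} (G : SimpleGraph V)

/-- A `u`-`v` geodesic: a `u`-`v` path whose length is the distance between `u` and `v`. -/
def IsGeodesic {G : SimpleGraph V} {u v : V} (p : G.Walk u v) : Prop :=
  p.IsPath ∧ p.length = G.dist u v

/-- The set of edges of a walk, as edges of `G`. -/
def pathEdges {G : SimpleGraph V} {u v : V} (p : G.Walk u v) : Set G.edgeSet :=
  {e | (e : Sym2 V) ∈ p.edges}

/-- The set of internal vertices of a `u`-`v` path. -/
def internalVertices {G : SimpleGraph V} {u v : V} (p : G.Walk u v) : Set V :=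
  {x | x ∈ p.support ∧ x ≠ u ∧ x ≠ v}

/-- An edge-coloured path is rainbow if its edges have distinct colours. -/
def IsRainbow {G : SimpleGraph V} {C : Type*} (c : G.edgeSet → C) {u v : V}
    (p : G.Walk u v) : Prop :=
  Set.InjOn c (pathEdges p)

/-- A vertex-coloured path is vertex-rainbow if its internal vertices have distinct colours. -/
def IsVertexRainbow {G : SimpleGraph V} {C : Type*} (c : V → C) {u v : V}
    (p : G.Walk u v) : Prop :=
  Set.InjOn c (internalVertices p)

/-- A total-coloured path is total-rainbow if its edges and internal vertices all have distinct
colours. A total-colouring colours the vertices and the edges of `G`. -/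
def IsTotalRainbow {G : SimpleGraph V} {C : Type*} (c : V ⊕ G.edgeSet → C) {u v : V}
    (p : G.Walk u v) : Prop :=
  Set.InjOn c (Sum.inl '' internalVertices p ∪ Sum.inr '' pathEdges p)

/-- Strongly rainbow connected edge-colourings. -/
def IsStronglyRainbowConnected {C : Type*} (c : G.edgeSet → C) : Prop :=
  ∀ u v : V, ∃ p : G.Walk u v, IsGeodesic p ∧ IsRainbow c p

/-- Strongly rainbow vertex-connected vertex-colourings. -/
def IsStronglyRainbowVertexConnected {C : Type*} (c : V → C) : Prop :=
  ∀ u v : V, ∃ p : G.Walk u v, IsGeodesic p ∧ IsVertexRainbow c p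

/-- Strongly total rainbow connected total-colourings. -/
def IsStronglyTotalRainbowConnected {C : Type*} (c : V ⊕ G.edgeSet → C) : Prop :=
  ∀ u v : V, ∃ p : G.Walk u v, IsGeodesic p ∧ IsTotalRainbow c p

/-- The strong rainbow connection number `src(G)` of a non-trivial finite connected graph. -/
noncomputable def src : ℕ :=
  sInf {k | ∃ c : G.edgeSet → Fin k, G.IsStronglyRainbowConnected c}

open Classical in
/-- The strong rainbow vertex-connection number `srvc(G)` of a non-trivial finite connected graph.
For a complete graph no internal vertex has to be coloured, and by the usual convention the
number is `0`. -/
noncomputable def srvc : ℕ :=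
  if G = ⊤ then 0
  else sInf {k | ∃ c : V → Fin k, G.IsStronglyRainbowVertexConnected c}

/-- The strong total rainbow connection number `strc(G)` of a non-trivial finite connected
graph. -/
noncomputable def strc : ℕ :=
  sInf {k | ∃ c : V ⊕ G.edgeSet → Fin k, G.IsStronglyTotalRainbowConnected c}

end SimpleGraph

namespace SimpleGraph

variable {V W : Type*} {G : SimpleGraph V} {H : SimpleGraph W}

/-! ### Short walks and small distances -/

/-! Restricting a total colouring to edges or to vertices gives `src ≤ strc` and `srvc ≤ strc`. So
each claim needs one explicit colouring and one lower bound on `src` or `srvc`. All three graph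
families have diameter at most three, and `HasShortRainbowGeodesic` turns the colourings into finite
case checks.

(a) Blow up one vertex of the five-cycle to a clique. A colouring of the five-cycle pulls back,
giving `strc ≤ 3`. Conversely, a strong rainbow edge-colouring forces a suitable five-cycle to be
properly edge-coloured, and an odd cycle needs three colours.

(b) In `hubGraph` every two clique vertices `i`, `j` carry spokes whose only geodesic runs through
`i` and `j`, so `srvc ≥ s`. To use no more than `s` colours in total, the edge to the spoke `(i, m)`
gets colour `m < 4`, which is also a clique vertex colour. The path from `(i, m)` through `i` and
`j` to `(j, m')` then fails to be rainbow only if `m = m'`, `m = j` or `m' = i`. Exactly such pairs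
meet a common class, and hubs of that class give them a geodesic of length two. The apex keeps all
other distances at most three. The fixed palette is `0`–`12`, hence `13 ≤ s`.

(c) Attach `s` pendants to each vertex of a `t`-clique. Geodesics between pendants are unique, so
clique vertices get distinct colours, and so do the `s` pendant edges at one vertex. -/

theorem Walk.exists_eq_of_length_eq_two {u v : V} (p : G.Walk u v) (h : p.length = 2) :
    ∃ (a : V) (h₁ : G.Adj u a) (h₂ : G.Adj a v), p = .cons h₁ (.cons h₂ .nil) := by
  match p, h with
  | .cons h₁ (.cons h₂ .nil), _ => exact ⟨_, h₁, h₂, rfl⟩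

theorem Walk.exists_eq_of_length_eq_three {u v : V} (p : G.Walk u v) (h : p.length = 3) :
    ∃ (a b : V) (h₁ : G.Adj u a) (h₂ : G.Adj a b) (h₃ : G.Adj b v),
      p = .cons h₁ (.cons h₂ (.cons h₃ .nil)) := by
  match p, h with
  | .cons h₁ (.cons h₂ (.cons h₃ .nil)), _ => exact ⟨_, _, h₁, h₂, h₃, rfl⟩

theorem dist_eq_two_of_adj {u a v : V} (huv : u ≠ v) (hn : ¬ G.Adj u v) (h₁ : G.Adj u a)
    (h₂ : G.Adj a v) : G.dist u v = 2 := by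
  have hle : G.dist u v ≤ 2 := dist_le (.cons h₁ (.cons h₂ .nil))
  have hr : G.Reachable u v := ⟨.cons h₁ (.cons h₂ .nil)⟩
  have h0 : G.dist u v ≠ 0 := fun h => huv ((hr.dist_eq_zero_iff).1 h)
  have h1 : G.dist u v ≠ 1 := fun h => hn (dist_eq_one_iff_adj.1 h)
  omega

theorem dist_eq_three_of_adj {u a b v : V} (huv : u ≠ v) (hn : ¬ G.Adj u v)
    (hc : ∀ x, G.Adj u x → ¬ G.Adj x v) (h₁ : G.Adj u a) (h₂ : G.Adj a b) (h₃ : G.Adj b v) :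
    G.dist u v = 3 := by
  have hle : G.dist u v ≤ 3 := dist_le (.cons h₁ (.cons h₂ (.cons h₃ .nil)))
  have hr : G.Reachable u v := ⟨.cons h₁ (.cons h₂ (.cons h₃ .nil))⟩
  have h0 : G.dist u v ≠ 0 := fun h => huv ((hr.dist_eq_zero_iff).1 h)
  have h1 : G.dist u v ≠ 1 := fun h => hn (dist_eq_one_iff_adj.1 h)
  have h2 : G.dist u v ≠ 2 := by
    intro h
    obtain ⟨p, hp⟩ := hr.exists_walk_length_eq_dist
    obtain ⟨x, hx₁, hx₂, -⟩ := p.exists_eq_of_length_eq_two (hp.trans h)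
    exact hc x hx₁ hx₂
  omega

/-! ### Comparison of the three parameters -/

theorem IsTotalRainbow.isRainbow {C : Type*} {c : V ⊕ G.edgeSet → C} {u v : V} {p : G.Walk u v}
    (h : IsTotalRainbow c p) : IsRainbow (fun e => c (.inr e)) p := fun _ hx _ hy hxy =>
  Sum.inr_injective (h (.inr ⟨_, hx, rfl⟩) (.inr ⟨_, hy, rfl⟩) hxy)

theorem IsTotalRainbow.isVertexRainbow {C : Type*} {c : V ⊕ G.edgeSet → C} {u v : V}
    {p : G.Walk u v} (h : IsTotalRainbow c p) : IsVertexRainbow (fun x => c (.inl x)) p :=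
  fun _ hx _ hy hxy => Sum.inl_injective (h (.inl ⟨_, hx, rfl⟩) (.inl ⟨_, hy, rfl⟩) hxy)

/-- An injective colouring makes every geodesic rainbow. This rules out the junk value `sInf ∅ = 0`,
so the infima are attained. -/
theorem exists_isStronglyTotalRainbowConnected [Finite V] (hG : G.Connected) :
    ∃ (k : ℕ) (c : V ⊕ G.edgeSet → Fin k), G.IsStronglyTotalRainbowConnected c := by
  obtain ⟨k, ⟨e⟩⟩ := Finite.exists_equiv_fin (V ⊕ G.edgeSet)
  refine ⟨k, e, fun u v => ?_⟩
  obtain ⟨p, hp, hl⟩ := hG.exists_path_of_dist u v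
  exact ⟨p, ⟨hp, hl⟩, e.injective.injOn⟩

theorem exists_coloring_fin_strc [Finite V] (hG : G.Connected) :
    ∃ c : V ⊕ G.edgeSet → Fin G.strc, G.IsStronglyTotalRainbowConnected c :=
  Nat.sInf_mem (s := {k | ∃ c : V ⊕ G.edgeSet → Fin k, G.IsStronglyTotalRainbowConnected c})
    (exists_isStronglyTotalRainbowConnected hG)

theorem strc_le {k : ℕ} {c : V ⊕ G.edgeSet → Fin k} (hc : G.IsStronglyTotalRainbowConnected c) :
    G.strc ≤ k :=
  Nat.sInf_le ⟨c, hc⟩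

theorem src_le_strc [Finite V] (hG : G.Connected) : G.src ≤ G.strc := by
  obtain ⟨c, hc⟩ := exists_coloring_fin_strc hG
  refine Nat.sInf_le ⟨fun e => c (.inr e), fun u v => ?_⟩
  obtain ⟨p, hp, h⟩ := hc u v
  exact ⟨p, hp, h.isRainbow⟩

theorem exists_coloring_fin_src [Finite V] (hG : G.Connected) :
    ∃ c : G.edgeSet → Fin G.src, G.IsStronglyRainbowConnected c := by
  refine Nat.sInf_mem (s := {k | ∃ c : G.edgeSet → Fin k, G.IsStronglyRainbowConnected c}) ?_
  obtain ⟨c, hc⟩ := exists_coloring_fin_strc hG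
  refine ⟨_, fun e => c (.inr e), fun u v => ?_⟩
  obtain ⟨p, hp, h⟩ := hc u v
  exact ⟨p, hp, h.isRainbow⟩

theorem srvc_le {k : ℕ} {c : V → Fin k} (hc : G.IsStronglyRainbowVertexConnected c) :
    G.srvc ≤ k := by
  unfold srvc
  split_ifs
  · exact Nat.zero_le _
  · exact Nat.sInf_le ⟨c, hc⟩

theorem srvc_le_strc [Finite V] (hG : G.Connected) : G.srvc ≤ G.strc := by
  obtain ⟨c, hc⟩ := exists_coloring_fin_strc hG
  refine srvc_le (c := fun x => c (.inl x)) fun u v => ?_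
  obtain ⟨p, hp, h⟩ := hc u v
  exact ⟨p, hp, h.isVertexRainbow⟩

theorem exists_coloring_fin_srvc [Finite V] (hG : G.Connected) (hne : G ≠ ⊤) :
    ∃ c : V → Fin G.srvc, G.IsStronglyRainbowVertexConnected c := by
  unfold srvc
  rw [if_neg hne]
  refine Nat.sInf_mem (s := {k | ∃ c : V → Fin k, G.IsStronglyRainbowVertexConnected c}) ?_
  obtain ⟨c, hc⟩ := exists_coloring_fin_strc hG
  refine ⟨_, fun x => c (.inl x), fun u v => ?_⟩
  obtain ⟨p, hp, h⟩ := hc u v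
  exact ⟨p, hp, h.isVertexRainbow⟩

/-! ### Invariance under isomorphism -/

theorem IsGeodesic.map_iso (φ : G ≃g H) {u v : V} {p : G.Walk u v} (hp : IsGeodesic p) :
    IsGeodesic (p.map φ.toHom) := by
  refine ⟨hp.1.map φ.injective, ?_⟩
  have hr : H.Reachable (φ u) (φ v) := ⟨p.map φ.toHom⟩
  obtain ⟨q, hq⟩ := hr.exists_walk_length_eq_dist
  have h1 : H.dist (φ u) (φ v) ≤ p.length := by
    simpa using dist_le (p.map φ.toHom)
  have h2 : G.dist u v ≤ q.length := by
    have := dist_le (q.map φ.symm.toHom)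
    simpa using this
  have h3 := hp.2
  change (p.map φ.toHom).length = H.dist (φ u) (φ v)
  rw [Walk.length_map]
  omega

theorem symm_mem_internalVertices_of_mem_map (φ : G ≃g H) {u v : V} {p : G.Walk u v} {x : W}
    (hx : x ∈ internalVertices (p.map φ.toHom)) : φ.symm x ∈ internalVertices p := by
  obtain ⟨h1, h2, h3⟩ := hx
  rw [Walk.support_map, List.mem_map] at h1
  obtain ⟨y, hy, rfl⟩ := h1
  have e : φ.symm (φ.toHom y) = y := φ.symm_apply_apply y
  rw [e]
  exact ⟨hy, fun h => h2 (h ▸ rfl), fun h => h3 (h ▸ rfl)⟩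

theorem symm_mem_pathEdges_of_mem_map (φ : G ≃g H) {u v : V} {p : G.Walk u v} {e : H.edgeSet}
    (he : e ∈ pathEdges (p.map φ.toHom)) : φ.symm.mapEdgeSet e ∈ pathEdges p := by
  change (e : Sym2 W) ∈ (p.map φ.toHom).edges at he
  rw [Walk.edges_map, List.mem_map] at he
  obtain ⟨y, hy, h⟩ := he
  change Sym2.map φ.symm (e : Sym2 W) ∈ p.edges
  rw [← h]
  have : Sym2.map φ.symm (Sym2.map φ.toHom y) = y := by
    rw [Sym2.map_map]
    have hid : φ.symm ∘ φ.toHom = id := funext φ.symm_apply_apply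
    rw [hid, Sym2.map_id, id]
  rwa [this]

theorem IsStronglyTotalRainbowConnected.map_iso (φ : G ≃g H) {C : Type*}
    {c : V ⊕ G.edgeSet → C} (hc : G.IsStronglyTotalRainbowConnected c) :
    H.IsStronglyTotalRainbowConnected (c ∘ Sum.map φ.symm φ.symm.mapEdgeSet) := by
  intro u v
  obtain ⟨u, rfl⟩ := φ.surjective u
  obtain ⟨v, rfl⟩ := φ.surjective v
  obtain ⟨p, hp, h⟩ := hc u v
  refine ⟨p.map φ.toHom, hp.map_iso φ, Set.InjOn.comp h
    (Function.Injective.injOn (Sum.map_injective.2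
      ⟨φ.symm.injective, φ.symm.mapEdgeSet.injective⟩)) ?_⟩
  rintro _ (⟨x, hx, rfl⟩ | ⟨e, he, rfl⟩)
  · exact .inl ⟨_, symm_mem_internalVertices_of_mem_map φ hx, rfl⟩
  · exact .inr ⟨_, symm_mem_pathEdges_of_mem_map φ he, rfl⟩

theorem IsStronglyRainbowVertexConnected.map_iso (φ : G ≃g H) {C : Type*}
    {c : V → C} (hc : G.IsStronglyRainbowVertexConnected c) :
    H.IsStronglyRainbowVertexConnected (c ∘ φ.symm) := by
  intro u v
  obtain ⟨u, rfl⟩ := φ.surjective u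
  obtain ⟨v, rfl⟩ := φ.surjective v
  obtain ⟨p, hp, h⟩ := hc u v
  exact ⟨p.map φ.toHom, hp.map_iso φ, Set.InjOn.comp h φ.symm.injective.injOn
    fun x hx => symm_mem_internalVertices_of_mem_map φ hx⟩

/-- Needed because the graphs for (b) and (c) live on structured vertex types, while the theorem
asks for graphs on `Fin n`. -/
theorem Iso.strc_eq (φ : G ≃g H) : G.strc = H.strc := by
  unfold strc
  congr 1
  ext k
  exact ⟨fun ⟨_, hc⟩ => ⟨_, hc.map_iso φ⟩, fun ⟨_, hc⟩ => ⟨_, hc.map_iso φ.symm⟩⟩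

theorem Iso.srvc_eq (φ : G ≃g H) : G.srvc = H.srvc := by
  have htop : G = ⊤ ↔ H = ⊤ := by
    simp only [eq_top_iff_forall_ne_adj]
    constructor
    · intro h a b hab
      simpa using φ.map_adj_iff.2 (h (φ.symm a) (φ.symm b) (φ.symm.injective.ne hab))
    · intro h a b hab
      exact φ.map_adj_iff.1 (h _ _ (φ.injective.ne hab))
  unfold srvc
  by_cases hH : H = ⊤
  · rw [if_pos hH, if_pos (htop.2 hH)]
  · rw [if_neg hH, if_neg (htop.not.2 hH)]
    congr 1
    ext k
    exact ⟨fun ⟨_, hc⟩ => ⟨_, hc.map_iso φ⟩, fun ⟨_, hc⟩ => ⟨_, hc.map_iso φ.symm⟩⟩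

theorem exists_iso_fin [Finite V] (G : SimpleGraph V) :
    ∃ (n : ℕ) (H : SimpleGraph (Fin n)), Nonempty (G ≃g H) := by
  obtain ⟨n, ⟨e⟩⟩ := Finite.exists_equiv_fin V
  exact ⟨n, G.map e.toEmbedding, ⟨Iso.map e G⟩⟩

/-! ### Colourings of graphs of diameter at most three -/

/-- Two distinct non-adjacent vertices are joined by a total-rainbow geodesic of length two or
three. -/
def HasShortRainbowGeodesic (G : SimpleGraph V) (f : V → ℕ) (g : V → V → ℕ) (u v : V) : Prop :=
  (∃ a, G.Adj u a ∧ G.Adj a v ∧ [g u a, f a, g a v].Nodup) ∨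
    ((∀ a, G.Adj u a → ¬ G.Adj a v) ∧ ∃ a b, G.Adj u a ∧ G.Adj a b ∧ G.Adj b v ∧
      [g u a, f a, g a b, f b, g b v].Nodup)

theorem HasShortRainbowGeodesic.symm {f : V → ℕ} {g : V → V → ℕ} (hg : ∀ u v, g u v = g v u)
    {u v : V} (h : G.HasShortRainbowGeodesic f g u v) : G.HasShortRainbowGeodesic f g v u := by
  rcases h with ⟨a, h₁, h₂, h⟩ | ⟨hn, a, b, h₁, h₂, h₃, h⟩
  · refine .inl ⟨a, h₂.symm, h₁.symm, ?_⟩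
    simp only [hg v a, hg a u, List.nodup_cons, List.mem_cons, List.not_mem_nil] at h ⊢
    grind
  · refine .inr ⟨fun x hx hx' => hn x hx'.symm hx.symm, b, a, h₃.symm, h₂.symm, h₁.symm, ?_⟩
    simp only [hg v b, hg b a, hg a u, List.nodup_cons, List.mem_cons, List.not_mem_nil] at h ⊢
    grind

/-- Replaces injectivity on a set in the sum type by `Nodup` of a concrete list of colours. The list
`l` only has to contain the internal vertices. -/
theorem isTotalRainbow_of_nodup {C : Type*} {f : V → C} {g : Sym2 V → C} {u v : V}
    {p : G.Walk u v} {l : List V} (hl : ∀ x ∈ internalVertices p, x ∈ l)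
    (h : (l.map f ++ p.edges.map g).Nodup) :
    IsTotalRainbow (Sum.elim f fun e : G.edgeSet => g e) p := by
  have h' : ((l.map Sum.inl ++ p.edges.map Sum.inr).map (Sum.elim f g)).Nodup := by
    simpa [Function.comp_def] using h
  have key := List.inj_on_of_nodup_map h'
  rintro _ (⟨x, hx, rfl⟩ | ⟨x, hx, rfl⟩) _ (⟨y, hy, rfl⟩ | ⟨y, hy, rfl⟩) hxy
  · have := key (x := .inl x) (by simp [hl x hx]) (y := .inl y) (by simp [hl y hy]) hxy
    simpa using this
  · have := key (x := .inl x) (by simp [hl x hx]) (y := .inr y)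
      (by simpa [pathEdges] using hy) hxy
    simp at this
  · have := key (x := .inr x) (by simpa [pathEdges] using hx) (y := .inl y)
      (by simp [hl y hy]) hxy
    simp at this
  · have := key (x := .inr x) (by simpa [pathEdges] using hx) (y := .inr y)
      (by simpa [pathEdges] using hy) hxy
    simpa [Subtype.ext_iff] using this

theorem isStronglyTotalRainbowConnected_of_hasShortRainbowGeodesic (f : V → ℕ) (g : V → V → ℕ)
    (hsymm : ∀ u v, g u v = g v u)
    (h : ∀ u v, u ≠ v → ¬ G.Adj u v → G.HasShortRainbowGeodesic f g u v) :
    G.IsStronglyTotalRainbowConnected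
      (Sum.elim f fun e : G.edgeSet => Sym2.lift ⟨g, hsymm⟩ (e : Sym2 V)) := by
  intro u v
  rcases eq_or_ne u v with rfl | huv
  · exact ⟨.nil, ⟨.nil, by simp⟩, isTotalRainbow_of_nodup (l := [])
      (by simp +contextual [internalVertices]) (by simp)⟩
  by_cases hadj : G.Adj u v
  · refine ⟨.cons hadj .nil, ⟨by simp [huv], by simp [dist_eq_one_iff_adj.2 hadj]⟩,
      isTotalRainbow_of_nodup (l := []) ?_ (by simp)⟩
    rintro x ⟨h1, h2, h3⟩
    simp_all
  rcases h u v huv hadj with ⟨a, h₁, h₂, hn⟩ | ⟨hc, a, b, h₁, h₂, h₃, hn⟩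
  · have hd := dist_eq_two_of_adj huv hadj h₁ h₂
    refine ⟨.cons h₁ (.cons h₂ .nil), ⟨Walk.isPath_of_length_eq_dist _ (by simp [hd]),
      by simp [hd]⟩, isTotalRainbow_of_nodup (l := [a]) ?_ ?_⟩
    · rintro x ⟨h1, h2, h3⟩
      simp_all
    · simp only [Walk.edges_cons, Walk.edges_nil, List.map_cons, List.map_nil]
      change [f a, g u a, g a v].Nodup
      simp only [List.nodup_cons, List.mem_cons, List.not_mem_nil] at hn ⊢
      grind
  · have hd := dist_eq_three_of_adj huv hadj hc h₁ h₂ h₃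
    refine ⟨.cons h₁ (.cons h₂ (.cons h₃ .nil)), ⟨Walk.isPath_of_length_eq_dist _ (by simp [hd]),
      by simp [hd]⟩, isTotalRainbow_of_nodup (l := [a, b]) ?_ ?_⟩
    · rintro x ⟨h1, h2, h3⟩
      simp_all
    · simp only [Walk.edges_cons, Walk.edges_nil, List.map_cons, List.map_nil]
      change [f a, f b, g u a, g a b, g b v].Nodup
      simp only [List.nodup_cons, List.mem_cons, List.not_mem_nil] at hn ⊢
      grind

theorem IsStronglyTotalRainbowConnected.connected {C : Type*} [Nonempty V]
    {c : V ⊕ G.edgeSet → C} (hc : G.IsStronglyTotalRainbowConnected c) : G.Connected :=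
  ⟨fun u v => ⟨(hc u v).choose⟩⟩

theorem exists_coloring_of_hasShortRainbowGeodesic {k : ℕ} (f : V → ℕ) (g : V → V → ℕ)
    (hsymm : ∀ u v, g u v = g v u) (hf : ∀ u, f u < k) (hg : ∀ u v, g u v < k)
    (h : ∀ u v, u ≠ v → ¬ G.Adj u v → G.HasShortRainbowGeodesic f g u v) :
    ∃ c : V ⊕ G.edgeSet → Fin k, G.IsStronglyTotalRainbowConnected c := by
  have hgs : ∀ e, Sym2.lift ⟨g, hsymm⟩ e < k := by
    rintro ⟨u, v⟩
    exact hg u v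
  refine ⟨Sum.elim (fun x => ⟨f x, hf x⟩) (fun e => ⟨_, hgs e⟩), fun u v => ?_⟩
  obtain ⟨p, hp, hr⟩ :=
    isStronglyTotalRainbowConnected_of_hasShortRainbowGeodesic f g hsymm h u v
  refine ⟨p, hp, fun x hx y hy hxy => hr hx hy ?_⟩
  replace hxy := congrArg Fin.val hxy
  rcases x with x | x <;> rcases y with y | y <;> exact hxy

/-! ### Consequences of a strong rainbow colouring for vertices at distance two or three -/

theorem IsStronglyRainbowConnected.exists_ne_of_dist_eq_two {C : Type*} {c : G.edgeSet → C}
    (hc : G.IsStronglyRainbowConnected c) {u v : V} (hd : G.dist u v = 2) :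
    ∃ (a : V) (h₁ : G.Adj u a) (h₂ : G.Adj a v), c ⟨s(u, a), h₁⟩ ≠ c ⟨s(a, v), h₂⟩ := by
  obtain ⟨p, hp, hr⟩ := hc u v
  obtain ⟨a, h₁, h₂, rfl⟩ := p.exists_eq_of_length_eq_two (hp.2.trans hd)
  refine ⟨a, h₁, h₂, fun h => ?_⟩
  have huv : u ≠ v := by
    rintro rfl
    simp at hd
  have := hr (x₁ := ⟨s(u, a), h₁⟩) (by simp [pathEdges]) (x₂ := ⟨s(a, v), h₂⟩)
    (by simp [pathEdges]) h
  have he := congrArg Subtype.val this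
  have hv := h₂.ne
  rw [Sym2.eq_iff] at he
  grind

theorem IsStronglyRainbowVertexConnected.exists_ne_of_dist_eq_three {C : Type*} {c : V → C}
    (hc : G.IsStronglyRainbowVertexConnected c) {u v : V} (hd : G.dist u v = 3) :
    ∃ a b : V, G.Adj u a ∧ G.Adj a b ∧ G.Adj b v ∧ c a ≠ c b := by
  obtain ⟨p, hp, hr⟩ := hc u v
  obtain ⟨a, b, h₁, h₂, h₃, rfl⟩ := p.exists_eq_of_length_eq_three (hp.2.trans hd)
  refine ⟨a, b, h₁, h₂, h₃, fun h => h₂.ne (hr ?_ ?_ h)⟩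
  · refine ⟨by simp, h₁.ne', ?_⟩
    rintro rfl
    have := dist_le (.cons h₁ .nil)
    simp at this
    omega
  · refine ⟨by simp, ?_, h₃.ne⟩
    rintro rfl
    have := dist_le (.cons h₃ .nil)
    simp at this
    omega

end SimpleGraph

namespace SimpleGraph

/-! ### The five-cycle with one vertex blown up to a clique -/

/-- The projection of the blow-up to the five-cycle. The vertex `4` is the one blown up. -/
def blowUpProj (i : ℕ) (u : Fin (i + 5)) : Fin 5 := ⟨min u.val 4, by omega⟩

/-- The five-cycle with the vertex `4` replaced by a clique with `i + 1` vertices. -/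
def blowUpCycle (i : ℕ) : SimpleGraph (Fin (i + 5)) where
  Adj u v := u ≠ v ∧ (blowUpProj i u = blowUpProj i v ∨ blowUpProj i v = blowUpProj i u + 1 ∨
    blowUpProj i u = blowUpProj i v + 1)
  symm := ⟨fun u v h => ⟨h.1.symm, by tauto⟩⟩
  loopless := ⟨fun u h => h.1 rfl⟩

/-- A vertex of the blow-up over the vertex `x` of the five-cycle. -/
def blowUpSection (i : ℕ) (x : Fin 5) : Fin (i + 5) := ⟨x.val, by omega⟩

@[simp]
theorem blowUpProj_section (i : ℕ) (x : Fin 5) : blowUpProj i (blowUpSection i x) = x :=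
  Fin.ext (by simp only [blowUpProj, blowUpSection]; omega)

theorem eq_section_of_blowUpProj {i : ℕ} {u : Fin (i + 5)} {x : Fin 5} (hx : x ≠ 4)
    (h : blowUpProj i u = x) : u = blowUpSection i x := by
  subst h
  have : (blowUpProj i u).val ≠ 4 := fun h => hx (Fin.ext h)
  refine Fin.ext ?_
  simp only [blowUpProj, blowUpSection] at this ⊢
  omega

theorem blowUpCycle_adj {i : ℕ} {u v : Fin (i + 5)} : (blowUpCycle i).Adj u v ↔
    u ≠ v ∧ (blowUpProj i u = blowUpProj i v ∨ blowUpProj i v = blowUpProj i u + 1 ∨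
      blowUpProj i u = blowUpProj i v + 1) := Iff.rfl

theorem blowUpCycle_adj_of_succ {i : ℕ} {u v : Fin (i + 5)}
    (h : blowUpProj i v = blowUpProj i u + 1) : (blowUpCycle i).Adj u v := by
  refine ⟨?_, .inr (.inl h)⟩
  rintro rfl
  revert h
  generalize blowUpProj i u = x
  revert x
  decide

/-- Vertex colours of a strong total rainbow colouring of the five-cycle. -/
def cycleVertexColor : Fin 5 → ℕ := ![2, 2, 2, 0, 1]

/-- Edge colours of a strong total rainbow colouring of the five-cycle. -/
def cycleEdgeColor : Fin 5 → Fin 5 → ℕ :=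
  ![![0, 1, 0, 0, 0], ![1, 0, 0, 0, 0], ![0, 0, 0, 1, 0], ![0, 0, 1, 0, 2], ![0, 0, 0, 2, 0]]

/-- The edges of the five-cycle are properly coloured with three colours, and each vertex takes the
colour missing at it, so every path of length two is total-rainbow. Non-adjacent vertices of the
blow-up lie over non-adjacent vertices of the cycle, and the path between those lifts. Edges inside
the clique are not needed. -/
theorem exists_coloring_blowUpCycle (i : ℕ) :
    ∃ c : Fin (i + 5) ⊕ (blowUpCycle i).edgeSet → Fin 3,
      (blowUpCycle i).IsStronglyTotalRainbowConnected c := by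
  refine exists_coloring_of_hasShortRainbowGeodesic (fun u => cycleVertexColor (blowUpProj i u))
    (fun u v => cycleEdgeColor (blowUpProj i u) (blowUpProj i v)) (fun u v => ?_) (fun u => ?_)
    (fun u v => ?_) (fun u v huv hn => ?_)
  · have : ∀ x y, cycleEdgeColor x y = cycleEdgeColor y x := by decide
    exact this _ _
  · have : ∀ x, cycleVertexColor x < 3 := by decide
    exact this _
  · have : ∀ x y, cycleEdgeColor x y < 3 := by decide
    exact this _ _
  · have key : ∀ x y : Fin 5, ¬ (x = y ∨ y = x + 1 ∨ x = y + 1) →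
        ∃ z, ((z = x + 1 ∧ y = z + 1) ∨ (x = z + 1 ∧ z = y + 1)) ∧
          [cycleEdgeColor x z, cycleVertexColor z, cycleEdgeColor z y].Nodup := by decide
    obtain ⟨z, hz, hnd⟩ := key _ _ (fun h => hn ⟨huv, h⟩)
    refine .inl ⟨blowUpSection i z, ?_, ?_, by simpa using hnd⟩
    · rcases hz with hz | hz
      · exact blowUpCycle_adj_of_succ (by simpa using hz.1)
      · exact (blowUpCycle_adj_of_succ (by simpa using hz.1)).symm
    · rcases hz with hz | hz
      · exact blowUpCycle_adj_of_succ (by simpa using hz.2)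
      · exact (blowUpCycle_adj_of_succ (by simpa using hz.2)).symm

theorem connected_blowUpCycle (i : ℕ) : (blowUpCycle i).Connected :=
  (exists_coloring_blowUpCycle i).choose_spec.connected

/-- Vertices over cycle vertices at distance two have all their common neighbours over the middle
one. That midpoint is unique unless the middle one is the blown-up vertex `4`. -/
theorem three_le_src_blowUpCycle (i : ℕ) : 3 ≤ (blowUpCycle i).src := by
  obtain ⟨c, hc⟩ := exists_coloring_fin_src (connected_blowUpCycle i)
  -- two vertices over vertices of the cycle at distance two
  have step : ∀ (u v : Fin (i + 5)) (x : Fin 5), x = blowUpProj i u + 1 →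
      blowUpProj i v = x + 1 → ∃ (a : Fin (i + 5)) (_ : blowUpProj i a = x)
        (h₁ : (blowUpCycle i).Adj u a) (h₂ : (blowUpCycle i).Adj a v),
        c ⟨s(u, a), h₁⟩ ≠ c ⟨s(a, v), h₂⟩ := by
    intro u v x hx hv
    have hfar : ∀ y : Fin 5, ¬ (y = y + 1 + 1 ∨ y + 1 + 1 = y + 1 ∨ y = y + 1 + 1 + 1) := by
      decide
    have hmid : ∀ y z : Fin 5, (y = z ∨ z = y + 1 ∨ y = z + 1) →
        (z = y + 1 + 1 ∨ y + 1 + 1 = z + 1 ∨ z = y + 1 + 1 + 1) → z = y + 1 := by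
      decide
    have hnadj : ¬ (blowUpCycle i).Adj u v := by
      rw [blowUpCycle_adj, hv, hx]
      exact fun h => hfar _ h.2
    have hne : u ≠ v := by
      rintro rfl
      rw [hx] at hv
      exact hfar _ (.inl hv)
    have hd : (blowUpCycle i).dist u v = 2 := dist_eq_two_of_adj hne hnadj
      (blowUpCycle_adj_of_succ (v := blowUpSection i x) (by simpa using hx))
      (blowUpCycle_adj_of_succ (by simpa using hv))
    obtain ⟨a, h₁, h₂, h⟩ := hc.exists_ne_of_dist_eq_two hd
    refine ⟨a, ?_, h₁, h₂, h⟩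
    have e₂ := h₂.2
    rw [hv, hx] at e₂
    rw [hx]
    exact hmid _ _ h₁.2 e₂
  -- Only here is there a choice of midpoint. Fixing this `k` over `4` selects the five-cycle `0, 1,
  -- 2, 3, k`; the other four midpoints are forced.
  obtain ⟨k, hk, h₁, h₂, hA⟩ := step (blowUpSection i 3) (blowUpSection i 0) 4
    (by simp) (by simp)
  have mid : ∀ (u v : Fin (i + 5)) (x : Fin 5), x ≠ 4 → x = blowUpProj i u + 1 →
      blowUpProj i v = x + 1 →
      ∃ (h₁ : (blowUpCycle i).Adj u (blowUpSection i x))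
        (h₂ : (blowUpCycle i).Adj (blowUpSection i x) v),
          c ⟨s(u, blowUpSection i x), h₁⟩ ≠ c ⟨s(blowUpSection i x, v), h₂⟩ := by
    intro u v x hx hu hv
    obtain ⟨a, ha, h₁, h₂, h⟩ := step u v x hu hv
    obtain rfl := eq_section_of_blowUpProj hx ha
    exact ⟨h₁, h₂, h⟩
  obtain ⟨_, _, hB⟩ := mid k (blowUpSection i 1) 0 (by decide) (by rw [hk]; decide)
    (by simp)
  obtain ⟨_, _, hC⟩ := mid (blowUpSection i 0) (blowUpSection i 2) 1 (by decide) (by simp)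
    (by simp)
  obtain ⟨_, _, hD⟩ := mid (blowUpSection i 1) (blowUpSection i 3) 2 (by decide) (by simp)
    (by simp)
  obtain ⟨_, _, hE⟩ := mid (blowUpSection i 2) k 3 (by decide) (by simp)
    (by rw [hk]; decide)
  -- The five inequalities say that consecutive edges of an odd cycle differ, which is impossible
  -- with at most two colours.
  by_contra hlt
  simp only [ne_eq, Fin.ext_iff] at hA hB hC hD hE
  omega

theorem src_blowUpCycle (i : ℕ) : (blowUpCycle i).src = 3 :=
  le_antisymm ((src_le_strc (connected_blowUpCycle i)).trans
    (strc_le (exists_coloring_blowUpCycle i).choose_spec)) (three_le_src_blowUpCycle i)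

theorem strc_blowUpCycle (i : ℕ) : (blowUpCycle i).strc = 3 :=
  le_antisymm (strc_le (exists_coloring_blowUpCycle i).choose_spec)
    ((three_le_src_blowUpCycle i).trans (src_le_strc (connected_blowUpCycle i)))

end SimpleGraph

namespace SimpleGraph

/-! ### Complete graphs with pendant vertices -/

/-- The complete graph on `Fin t` with `s` pendant vertices attached to every vertex. -/
def pendantClique (t s : ℕ) : SimpleGraph (Fin t ⊕ Fin t × Fin s) where
  Adj u v := match u, v with
    | .inl i, .inl j => i ≠ j
    | .inl i, .inr p => i = p.1
    | .inr p, .inl i => i = p.1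
    | .inr _, .inr _ => False
  symm := ⟨by rintro (i | p) (j | q) h <;> first | exact h | exact h.symm⟩
  loopless := ⟨by rintro (i | p) h <;> simp at h⟩

variable {t s : ℕ}

@[simp] theorem pendantClique_adj_inl_inl {i j : Fin t} :
    (pendantClique t s).Adj (.inl i) (.inl j) ↔ i ≠ j := Iff.rfl

@[simp] theorem pendantClique_adj_inl_inr {i : Fin t} {p : Fin t × Fin s} :
    (pendantClique t s).Adj (.inl i) (.inr p) ↔ i = p.1 := Iff.rfl

@[simp] theorem pendantClique_adj_inr_inl {i : Fin t} {p : Fin t × Fin s} :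
    (pendantClique t s).Adj (.inr p) (.inl i) ↔ i = p.1 := Iff.rfl

@[simp] theorem pendantClique_adj_inr_inr {p q : Fin t × Fin s} :
    ¬ (pendantClique t s).Adj (.inr p) (.inr q) := id

theorem pendantClique_adj_inr {p : Fin t × Fin s} {v : Fin t ⊕ Fin t × Fin s} :
    (pendantClique t s).Adj (.inr p) v ↔ v = .inl p.1 := by
  rcases v with i | q <;> simp

theorem pendantClique_adj_to_inr {p : Fin t × Fin s} {v : Fin t ⊕ Fin t × Fin s} :
    (pendantClique t s).Adj v (.inr p) ↔ v = .inl p.1 := by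
  rw [adj_comm, pendantClique_adj_inr]

/-- Vertex colours on the clique with pendant vertices. -/
def pendantVertexColor : Fin t ⊕ Fin t × Fin s → ℕ :=
  Sum.elim (fun i => i.val) fun _ => 0

/-- Edge colours on the clique with pendant vertices. -/
def pendantEdgeColor (u v : Fin t ⊕ Fin t × Fin s) : ℕ :=
  match u, v with
  | .inl _, .inr p => t + 1 + Nat.pair p.1 p.2
  | .inr p, .inl _ => t + 1 + Nat.pair p.1 p.2
  | _, _ => t

/-- Edge colours come from all of `ℕ`: only the vertex colours, which stay below `t`, matter for
bounding `srvc`. Pendants are never internal, so their colour is irrelevant. -/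
theorem isStronglyTotalRainbowConnected_pendantClique :
    ∃ g : (pendantClique t s).edgeSet → ℕ,
      (pendantClique t s).IsStronglyTotalRainbowConnected (Sum.elim pendantVertexColor g) := by
  refine ⟨_, isStronglyTotalRainbowConnected_of_hasShortRainbowGeodesic pendantVertexColor
    pendantEdgeColor ?_ ?_⟩
  · rintro (i | p) (j | q) <;> rfl
  rintro (i | p) (j | q) hne hn
  · exact absurd (fun h => hne (congrArg _ h)) hn
  · have h : i ≠ q.1 := hn
    refine .inl ⟨.inl q.1, h, rfl, ?_⟩
    have := q.1.isLt
    simp [pendantEdgeColor, pendantVertexColor]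
    omega
  · have h : j ≠ p.1 := hn
    refine .inl ⟨.inl p.1, rfl, h.symm, ?_⟩
    have := p.1.isLt
    simp [pendantEdgeColor, pendantVertexColor]
    omega
  · have hp := p.1.isLt
    have hq := q.1.isLt
    have hpair : Nat.pair p.1 p.2 ≠ Nat.pair q.1 q.2 := by
      intro h
      rw [Nat.pair_eq_pair] at h
      exact hne (congrArg _ (Prod.ext (Fin.ext h.1) (Fin.ext h.2)))
    by_cases h : p.1 = q.1
    · refine .inl ⟨.inl p.1, rfl, h, ?_⟩
      simp [pendantEdgeColor, pendantVertexColor, hpair]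
      omega
    · refine .inr ⟨fun x hx hx' => ?_, .inl p.1, .inl q.1, rfl, h, rfl, ?_⟩
      · rw [pendantClique_adj_inr] at hx
        subst hx
        exact h hx'
      · have h' : p.1.val ≠ q.1.val := fun e => h (Fin.ext e)
        simp [pendantEdgeColor, pendantVertexColor, hpair]
        omega

theorem connected_pendantClique (ht : 0 < t) : (pendantClique t s).Connected :=
  have : Nonempty (Fin t ⊕ Fin t × Fin s) := ⟨.inl ⟨0, ht⟩⟩
  isStronglyTotalRainbowConnected_pendantClique.choose_spec.connected

/-- Two pendants at one clique vertex are not adjacent. For `t = s = 1` the graph would be a single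
edge, with `srvc` equal to `0` by convention. -/
theorem pendantClique_ne_top (ht : 0 < t) (hs : 1 < s) : pendantClique t s ≠ ⊤ := by
  intro h
  have := eq_top_iff_forall_ne_adj.1 h (.inr (⟨0, ht⟩, ⟨0, by omega⟩)) (.inr (⟨0, ht⟩, ⟨1, hs⟩))
    (by simp)
  exact this

theorem srvc_pendantClique (ht : 0 < t) (hs : 1 < s) : (pendantClique t s).srvc = t := by
  apply le_antisymm
  · obtain ⟨g, hc⟩ := isStronglyTotalRainbowConnected_pendantClique (t := t) (s := s)
    refine srvc_le (c := fun u => ⟨pendantVertexColor u, ?_⟩) fun u v => ?_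
    · rcases u with i | p
      · exact i.isLt
      · exact ht
    · obtain ⟨p, hp, hr⟩ := hc u v
      exact ⟨p, hp, fun x hx y hy hxy => hr.isVertexRainbow hx hy (congrArg Fin.val hxy)⟩
  · obtain ⟨c, hc⟩ := exists_coloring_fin_srvc (connected_pendantClique (s := s) ht)
      (pendantClique_ne_top ht hs)
    have hinj : Function.Injective fun i : Fin t => c (.inl i) := by
      intro i j hij
      by_contra hne
      have hd : (pendantClique t s).dist (.inr (i, ⟨0, by omega⟩)) (.inr (j, ⟨0, by omega⟩)) = 3 :=
        dist_eq_three_of_adj (by simpa using hne) id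
          (fun x hx hx' => by
            rw [pendantClique_adj_inr] at hx
            subst hx
            exact hne hx') (pendantClique_adj_inr_inl.2 rfl) (pendantClique_adj_inl_inl.2 hne)
          (pendantClique_adj_inl_inr.2 rfl)
      obtain ⟨a, b, h₁, -, h₂, h⟩ := hc.exists_ne_of_dist_eq_three hd
      rw [pendantClique_adj_inr] at h₁
      rw [pendantClique_adj_to_inr] at h₂
      subst h₁ h₂
      exact h hij
    simpa using Fintype.card_le_of_injective _ hinj

theorem le_strc_pendantClique (ht : 0 < t) : s ≤ (pendantClique t s).strc := by
  refine le_trans ?_ (src_le_strc (connected_pendantClique ht))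
  obtain ⟨c, hc⟩ := exists_coloring_fin_src (connected_pendantClique (s := s) ht)
  let z : Fin t := ⟨0, ht⟩
  have hadj (r : Fin s) : (pendantClique t s).Adj (.inl z) (.inr (z, r)) := rfl
  have hinj : Function.Injective fun r : Fin s => c ⟨s(.inl z, .inr (z, r)), hadj r⟩ := by
    intro r r' hrr
    by_contra hne
    have hd : (pendantClique t s).dist (.inr (z, r)) (.inr (z, r')) = 2 :=
      dist_eq_two_of_adj (by simpa using hne) id (pendantClique_adj_inr_inl.2 rfl) (hadj r')
    obtain ⟨a, h₁, h₂, h⟩ := hc.exists_ne_of_dist_eq_two hd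
    obtain rfl := pendantClique_adj_inr.1 h₁
    refine h (Eq.trans ?_ hrr)
    congr 2
    exact Sym2.eq_swap
  simpa using Fintype.card_le_of_injective _ hinj

end SimpleGraph

namespace SimpleGraph

/-! ### A graph whose total and vertex parameters agree -/

/-- The vertices attached to the clique: `(i, m)` is attached to the clique vertex `i`, and `m` is
the colour of the attaching edge. -/
abbrev Spoke (s : ℕ) : Type := {q : Fin s × Fin 4 // q.1.val ≠ q.2.val}

/-- The vertices of the hub graph. -/
inductive HubVertex (s : ℕ) : Type
  | clique (i : Fin s)
  | spoke (q : Spoke s)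
  | hub (x : Fin 4) (κ : Spoke s)
  | apex

/-- The hub class `x` is one of the two indices of the spoke `q`. -/
def Spoke.Meets {s : ℕ} (q : Spoke s) (x : Fin 4) : Prop :=
  x.val = q.1.1.val ∨ x = q.1.2

namespace HubVertex

variable {s : ℕ}

theorem finite : Finite (HubVertex s) := by
  let f : Fin s ⊕ Spoke s ⊕ Fin 4 × Spoke s ⊕ Unit → HubVertex s :=
    Sum.elim clique (Sum.elim spoke (Sum.elim (fun p => hub p.1 p.2) fun _ => apex))
  refine Finite.of_surjective f ?_
  rintro (i | q | ⟨x, κ⟩ | _)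
  exacts [⟨.inl i, rfl⟩, ⟨.inr (.inl q), rfl⟩, ⟨.inr (.inr (.inl (x, κ))), rfl⟩,
    ⟨.inr (.inr (.inr ())), rfl⟩]

/-- Adjacency in the hub graph. -/
def Adj : HubVertex s → HubVertex s → Prop
  | clique i, clique j => i ≠ j
  | clique i, spoke q => i = q.1.1
  | spoke q, clique i => i = q.1.1
  | spoke q, hub x _ => q.Meets x
  | hub x _, spoke q => q.Meets x
  | hub x κ, hub y κ' => x = y ∧ κ ≠ κ'
  | hub _ _, apex => True
  | apex, hub _ _ => True
  | _, _ => False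

end HubVertex

open HubVertex

/-- A clique on `Fin s` with spokes attached to it, in which any two spokes with a common index
are joined through hubs, and all hubs are joined to an apex. -/
def hubGraph (s : ℕ) : SimpleGraph (HubVertex s) where
  Adj := HubVertex.Adj
  symm := ⟨by
    rintro (i | q | ⟨x, κ⟩ | _) (j | q' | ⟨y, κ'⟩ | _) h <;> simp_all only [HubVertex.Adj] <;>
      first | exact h.symm | exact ⟨trivial, h.2.symm⟩⟩
  loopless := ⟨by rintro (i | q | ⟨x, κ⟩ | _) h <;> simp [HubVertex.Adj] at h⟩

namespace HubVertex

variable {s : ℕ}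

theorem hubGraph_adj {u v : HubVertex s} : (hubGraph s).Adj u v ↔ HubVertex.Adj u v := Iff.rfl

/-- Vertex colours of the hub graph. -/
def vertexColor : HubVertex s → ℕ
  | clique i => i
  | spoke _ => 9
  | hub _ _ => 10
  | apex => 11

/-- A colour among `4`, `5`, `6` different from `i` and `j`. -/
def avoidingColor (i j : ℕ) : ℕ :=
  if i ≠ 4 ∧ j ≠ 4 then 4 else if i ≠ 5 ∧ j ≠ 5 then 5 else 6

theorem avoidingColor_spec (i j : ℕ) : avoidingColor i j ≠ i ∧ avoidingColor i j ≠ j ∧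
    4 ≤ avoidingColor i j ∧ avoidingColor i j ≤ 6 := by
  unfold avoidingColor
  grind

theorem avoidingColor_comm (i j : ℕ) : avoidingColor i j = avoidingColor j i := by
  unfold avoidingColor
  grind

/-- Colours of the edges between the apex and the hubs. -/
def apexColor : Fin 4 → ℕ := ![4, 5, 6, 12]

theorem apexColor_spec (x : Fin 4) :
    apexColor x = 4 ∨ apexColor x = 5 ∨ apexColor x = 6 ∨ apexColor x = 12 := by
  revert x
  decide

theorem apexColor_injective : Function.Injective apexColor := by decide

/-- Colours of the edges between the spokes and the hubs. -/
def hubColor (q κ : Spoke s) : ℕ := if q = κ then 7 else 8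

theorem hubColor_spec (q κ : Spoke s) : hubColor q κ = 7 ∨ hubColor q κ = 8 := by
  unfold hubColor
  grind

/-- Edge colours of the hub graph. -/
def edgeColor : HubVertex s → HubVertex s → ℕ
  | clique i, clique j => avoidingColor i j
  | clique _, spoke q => q.1.2
  | spoke q, clique _ => q.1.2
  | spoke q, hub _ κ => hubColor q κ
  | hub _ κ, spoke q => hubColor q κ
  | hub x _, apex => apexColor x
  | apex, hub x _ => apexColor x
  -- The only adjacent pairs left are hubs of the same class; no geodesic chosen below uses such an
  -- edge.
  | _, _ => 0

theorem edgeColor_comm (u v : HubVertex s) : edgeColor u v = edgeColor v u := by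
  rcases u with i | q | ⟨x, κ⟩ | _ <;> rcases v with j | q' | ⟨y, κ'⟩ | _ <;>
    simp only [edgeColor, avoidingColor_comm]

theorem vertexColor_lt (hs : 13 ≤ s) (u : HubVertex s) : vertexColor u < s := by
  rcases u with i | q | ⟨x, κ⟩ | _ <;> simp only [vertexColor] <;> omega

theorem edgeColor_lt (hs : 13 ≤ s) (u v : HubVertex s) : edgeColor u v < s := by
  rcases u with i | q | ⟨x, κ⟩ | _ <;> rcases v with j | q' | ⟨y, κ'⟩ | _ <;>
    simp only [edgeColor]
  · have := avoidingColor_spec i j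
    omega
  · omega
  · omega
  · omega
  · omega
  · omega
  · have := hubColor_spec q κ'
    omega
  · omega
  · omega
  · have := hubColor_spec q' κ
    omega
  · omega
  · have := apexColor_spec x
    omega
  · omega
  · omega
  · have := apexColor_spec y
    omega
  · omega

theorem spoke_spoke_common_iff {q q' : Spoke s} :
    (∃ a, (hubGraph s).Adj (spoke q) a ∧ (hubGraph s).Adj a (spoke q')) ↔
      q.1.1 = q'.1.1 ∨ ∃ x, q.Meets x ∧ q'.Meets x := by
  constructor
  · rintro ⟨i | r | ⟨x, κ⟩ | _, h, h'⟩
    · exact .inl (Eq.trans (Eq.symm h) h')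
    · exact h.elim
    · exact .inr ⟨x, h, h'⟩
    · exact h.elim
  · rintro (h | ⟨x, h, h'⟩)
    · exact ⟨clique q.1.1, rfl, h⟩
    · exact ⟨hub x q, h, h'⟩

/-- Three cases: a common clique vertex, a common hub class, or neither. In the second, the hub
indexed by `q` itself sees colour `7` towards `q` and `8` towards `q'`. In the third, having no
common class is what separates the spoke edge colours from each other and from the clique vertex
colours; the clique edge avoids `i`, `j` and `0`–`3`. -/
theorem hasShortRainbowGeodesic_spoke_spoke {q q' : Spoke s} (hne : q ≠ q') :
    (hubGraph s).HasShortRainbowGeodesic vertexColor edgeColor (spoke q) (spoke q') := by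
  have hq := q.2
  have hq' := q'.2
  by_cases hi : q.1.1 = q'.1.1
  · have hm : q.1.2.val ≠ q'.1.2.val := fun h => hne (Subtype.ext (Prod.ext hi (Fin.ext h)))
    refine .inl ⟨clique q.1.1, rfl, hi, ?_⟩
    rw [← hi] at hq'
    simp only [edgeColor, vertexColor, List.nodup_cons, List.mem_cons, List.not_mem_nil]
    grind
  have hi' : q.1.1.val ≠ q'.1.1.val := fun h => hi (Fin.ext h)
  by_cases hx : ∃ x, q.Meets x ∧ q'.Meets x
  · obtain ⟨x, h, h'⟩ := hx
    refine .inl ⟨hub x q, h, h', ?_⟩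
    simp [edgeColor, vertexColor, hubColor, hne.symm]
  · refine .inr ⟨fun a h h' => ?_, clique q.1.1, clique q'.1.1, rfl, hi, rfl, ?_⟩
    · exact (spoke_spoke_common_iff.1 ⟨a, h, h'⟩).elim hi hx
    · have h1 : q.1.2.val ≠ q'.1.1.val := fun h => hx ⟨q.1.2, .inr rfl, .inl h⟩
      have h2 : q'.1.2.val ≠ q.1.1.val := fun h => hx ⟨q'.1.2, .inl h, .inr rfl⟩
      have h3 : q.1.2.val ≠ q'.1.2.val := fun h => hx ⟨q.1.2, .inr rfl, .inr (Fin.ext h)⟩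
      have ha := avoidingColor_spec q.1.1 q'.1.1
      simp only [edgeColor, vertexColor, List.nodup_cons, List.mem_cons, List.not_mem_nil]
      grind

theorem hasShortRainbowGeodesic_spoke_clique {q : Spoke s} {j : Fin s} (hj : j ≠ q.1.1) :
    (hubGraph s).HasShortRainbowGeodesic vertexColor edgeColor (spoke q) (clique j) := by
  have hq := q.2
  refine .inl ⟨clique q.1.1, rfl, hj.symm, ?_⟩
  have ha := avoidingColor_spec q.1.1 j
  simp only [edgeColor, vertexColor, List.nodup_cons, List.mem_cons, List.not_mem_nil]
  grind

theorem exists_spoke (j : Fin s) : ∃ q : Spoke s, q.1.1 = j := by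
  by_cases h : j.val = 0
  · exact ⟨⟨(j, 1), by simp [h]⟩, rfl⟩
  · exact ⟨⟨(j, 0), by simpa using h⟩, rfl⟩

theorem hasShortRainbowGeodesic_hub_clique {x : Fin 4} {κ : Spoke s} {j : Fin s} :
    (hubGraph s).HasShortRainbowGeodesic vertexColor edgeColor (hub x κ) (clique j) := by
  obtain ⟨q, hqx, hqj⟩ : ∃ q : Spoke s, q.Meets x ∧ q.1.1 = j := by
    -- The spoke `(j, x)` does not exist when `j = x`, but then every spoke at `j` meets `x`.
    by_cases h : j.val = x.val
    · obtain ⟨q, hq⟩ := exists_spoke j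
      exact ⟨q, .inl (by rw [hq, h]), hq⟩
    · exact ⟨⟨(j, x), h⟩, .inr rfl, rfl⟩
  refine .inl ⟨spoke q, hqx, hqj.symm, ?_⟩
  have := hubColor_spec q κ
  simp only [edgeColor, vertexColor, List.nodup_cons, List.mem_cons, List.not_mem_nil]
  grind

/-- Apex edges to one class share a colour, so the path through the apex works only between
different classes; hubs within a class are adjacent instead. -/
theorem hasShortRainbowGeodesic_hub_hub {x y : Fin 4} {κ κ' : Spoke s} (hxy : x ≠ y) :
    (hubGraph s).HasShortRainbowGeodesic vertexColor edgeColor (hub x κ) (hub y κ') := by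
  refine .inl ⟨apex, trivial, trivial, ?_⟩
  have hx := apexColor_spec x
  have hy := apexColor_spec y
  have hne := apexColor_injective.ne hxy
  simp only [edgeColor, vertexColor, List.nodup_cons, List.mem_cons, List.not_mem_nil]
  grind

theorem hasShortRainbowGeodesic_hub_spoke {x : Fin 4} {κ q : Spoke s} (hqx : ¬ q.Meets x) :
    (hubGraph s).HasShortRainbowGeodesic vertexColor edgeColor (hub x κ) (spoke q) := by
  refine .inr ⟨?_, apex, hub q.1.2 q, trivial, trivial, .inr rfl, ?_⟩
  · rintro (i | r | ⟨y, κ'⟩ | _) h h'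
    · exact h
    · exact h'
    · obtain ⟨rfl, -⟩ := h
      exact hqx h'
    · exact h'
  · have hx := apexColor_spec x
    have hy := apexColor_spec q.1.2
    have hne := apexColor_injective.ne (fun h => hqx (.inr h))
    have := hubColor_spec q q
    simp only [edgeColor, vertexColor, List.nodup_cons, List.mem_cons, List.not_mem_nil,
      List.nodup_nil, or_false, not_or, not_false_eq_true, and_true]
    omega

theorem hasShortRainbowGeodesic_apex_spoke {q : Spoke s} :
    (hubGraph s).HasShortRainbowGeodesic vertexColor edgeColor apex (spoke q) := by
  refine .inl ⟨hub q.1.2 q, trivial, .inr rfl, ?_⟩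
  have hx := apexColor_spec q.1.2
  have := hubColor_spec q q
  simp only [edgeColor, vertexColor, List.nodup_cons, List.mem_cons, List.not_mem_nil]
  grind

theorem hasShortRainbowGeodesic_apex_clique {j : Fin s} :
    (hubGraph s).HasShortRainbowGeodesic vertexColor edgeColor apex (clique j) := by
  obtain ⟨q, hq⟩ := exists_spoke j
  refine .inr ⟨?_, hub q.1.2 q, spoke q, trivial, .inr rfl, hq.symm, ?_⟩
  · rintro (i | r | ⟨y, κ'⟩ | _) h h'
    · exact h
    · exact h
    · exact h'
    · exact h
  · have hx := apexColor_spec q.1.2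
    have := hubColor_spec q q
    have := q.1.2.isLt
    simp only [edgeColor, vertexColor, List.nodup_cons, List.mem_cons, List.not_mem_nil,
      List.nodup_nil, or_false, not_or, not_false_eq_true, and_true]
    omega

theorem hasShortRainbowGeodesic {u v : HubVertex s} (huv : u ≠ v)
    (hn : ¬ (hubGraph s).Adj u v) :
    (hubGraph s).HasShortRainbowGeodesic vertexColor edgeColor u v := by
  have sw {u v : HubVertex s}
      (h : (hubGraph s).HasShortRainbowGeodesic vertexColor edgeColor u v) :
      (hubGraph s).HasShortRainbowGeodesic vertexColor edgeColor v u := h.symm edgeColor_comm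
  rcases u with i | q | ⟨x, κ⟩ | _ <;> rcases v with j | q' | ⟨y, κ'⟩ | _
  · exact absurd (fun h => huv (congrArg _ h)) hn
  · exact sw (hasShortRainbowGeodesic_spoke_clique hn)
  · exact sw hasShortRainbowGeodesic_hub_clique
  · exact sw hasShortRainbowGeodesic_apex_clique
  · exact hasShortRainbowGeodesic_spoke_clique hn
  · exact hasShortRainbowGeodesic_spoke_spoke fun h => huv (congrArg _ h)
  · exact sw (hasShortRainbowGeodesic_hub_spoke hn)
  · exact sw hasShortRainbowGeodesic_apex_spoke
  · exact hasShortRainbowGeodesic_hub_clique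
  · exact hasShortRainbowGeodesic_hub_spoke hn
  · refine hasShortRainbowGeodesic_hub_hub fun h => hn ⟨h, fun h' => huv ?_⟩
    rw [h, h']
  · exact absurd trivial hn
  · exact hasShortRainbowGeodesic_apex_clique
  · exact hasShortRainbowGeodesic_apex_spoke
  · exact absurd trivial hn
  · exact absurd rfl huv

end HubVertex

variable {s : ℕ}

theorem exists_coloring_hubGraph (hs : 13 ≤ s) :
    ∃ c : HubVertex s ⊕ (hubGraph s).edgeSet → Fin s,
      (hubGraph s).IsStronglyTotalRainbowConnected c :=
  exists_coloring_of_hasShortRainbowGeodesic _ _ edgeColor_comm (vertexColor_lt hs)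
    (edgeColor_lt hs) fun _ _ => HubVertex.hasShortRainbowGeodesic

theorem connected_hubGraph (hs : 13 ≤ s) : (hubGraph s).Connected :=
  have : Nonempty (HubVertex s) := ⟨apex⟩
  (exists_coloring_hubGraph hs).choose_spec.connected

/-- This is why there are four classes: two may be lost to `i` and `j`, and two distinct ones must
remain. -/
theorem exists_two_avoiding (i j : ℕ) :
    ∃ m m' : Fin 4, i ≠ m ∧ j ≠ m ∧ i ≠ m' ∧ j ≠ m' ∧ m ≠ m' := by
  by_contra! h
  have h1 := h 0 1
  have h2 := h 0 2
  have h3 := h 0 3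
  have h4 := h 1 2
  have h5 := h 1 3
  have h6 := h 2 3
  simp at h1 h2 h3 h4 h5 h6
  grind

theorem ne_of_isStronglyRainbowVertexConnected_hubGraph {C : Type*} {c : HubVertex s → C}
    (hc : (hubGraph s).IsStronglyRainbowVertexConnected c) {i j : Fin s} (hij : i ≠ j) :
    c (clique i) ≠ c (clique j) := by
  obtain ⟨m, m', h1, h2, h3, h4, h5⟩ := exists_two_avoiding i j
  let q : Spoke s := ⟨(i, m), h1⟩
  let q' : Spoke s := ⟨(j, m'), h4⟩
  have hno : ¬ ∃ x, q.Meets x ∧ q'.Meets x := by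
    rintro ⟨x, h | h, h' | h'⟩ <;> simp only [q, q'] at h h'
    · exact hij (Fin.ext (h.symm.trans h'))
    · exact h3 (h' ▸ h.symm)
    · exact h2 (h ▸ h'.symm)
    · exact h5 (h.symm.trans h')
  have hd : (hubGraph s).dist (spoke q) (spoke q') = 3 :=
    dist_eq_three_of_adj (a := clique i) (b := clique j)
      (fun h => hij (congrArg (fun r : Spoke s => r.1.1) (HubVertex.spoke.inj h))) id
      (fun a h h' => (spoke_spoke_common_iff.1 ⟨a, h, h'⟩).elim hij hno)
      (hubGraph_adj.2 rfl) (hubGraph_adj.2 hij) (hubGraph_adj.2 rfl)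
  obtain ⟨a, b, ha, hab, hb, h⟩ := hc.exists_ne_of_dist_eq_three hd
  rcases a with a | r | ⟨x, κ⟩ | _ <;> rcases b with b | r' | ⟨y, κ'⟩ | _
  · obtain rfl : a = i := ha
    obtain rfl : b = j := hb
    exact h
  · exact hb.elim
  · exact hab.elim
  · exact hb.elim
  · exact ha.elim
  · exact ha.elim
  · exact ha.elim
  · exact ha.elim
  · exact hab.elim
  · exact hb.elim
  -- A path through two adjacent hubs stays in one class, which both spokes would then meet.
  · obtain ⟨rfl, -⟩ := hab
    exact (hno ⟨_, ha, hb⟩).elim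
  · exact hb.elim
  · exact ha.elim
  · exact ha.elim
  · exact ha.elim
  · exact ha.elim

theorem hubGraph_ne_top (hs : 0 < s) : hubGraph s ≠ ⊤ := fun h =>
  eq_top_iff_forall_ne_adj.1 h (clique ⟨0, hs⟩) apex nofun

theorem le_srvc_hubGraph (hs : 13 ≤ s) : s ≤ (hubGraph s).srvc := by
  have : Finite (HubVertex s) := HubVertex.finite
  obtain ⟨c, hc⟩ := exists_coloring_fin_srvc (connected_hubGraph hs) (hubGraph_ne_top (by omega))
  have hinj : Function.Injective fun i : Fin s => c (clique i) := by
    intro i j h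
    by_contra hij
    exact ne_of_isStronglyRainbowVertexConnected_hubGraph hc hij h
  simpa using Fintype.card_le_of_injective _ hinj

theorem strc_hubGraph (hs : 13 ≤ s) : (hubGraph s).strc = s :=
  have : Finite (HubVertex s) := HubVertex.finite
  le_antisymm (strc_le (exists_coloring_hubGraph hs).choose_spec)
    ((le_srvc_hubGraph hs).trans (srvc_le_strc (connected_hubGraph hs)))

theorem srvc_hubGraph (hs : 13 ≤ s) : (hubGraph s).srvc = s :=
  have : Finite (HubVertex s) := HubVertex.finite
  le_antisymm ((srvc_le_strc (connected_hubGraph hs)).trans (strc_hubGraph hs).le)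
    (le_srvc_hubGraph hs)

/-! ### Passing to graphs on `Fin n` -/

theorem exists_fin_of_connected {V : Type*} [Finite V] [Nontrivial V] {G : SimpleGraph V}
    (hG : G.Connected) : ∃ (n : ℕ) (H : SimpleGraph (Fin n)),
      2 ≤ n ∧ H.Connected ∧ H.strc = G.strc ∧ H.srvc = G.srvc := by
  obtain ⟨n, H, ⟨φ⟩⟩ := exists_iso_fin G
  have : Nontrivial (Fin n) := φ.symm.toEquiv.nontrivial
  exact ⟨n, H, Fin.nontrivial_iff_two_le.1 this, φ.connected_iff.1 hG, φ.symm.strc_eq,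
    φ.symm.srvc_eq⟩

end SimpleGraph

open SimpleGraph in
theorem theorem4p3 :
    -- (a) infinitely many pairwise non-isomorphic graphs
    (∃ (n : ℕ → ℕ) (G : ∀ i : ℕ, SimpleGraph (Fin (n i))),
      (∀ i, 2 ≤ n i ∧ (G i).Connected ∧ (G i).strc = 3 ∧ (G i).src = 3) ∧
      ∀ i j, i ≠ j → IsEmpty (G i ≃g G j)) ∧
    -- (b)
    (∀ s : ℕ, 13 ≤ s → ∃ (n : ℕ) (G : SimpleGraph (Fin n)),
      2 ≤ n ∧ G.Connected ∧ G.strc = s ∧ G.srvc = s) ∧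
    -- (c)
    (∀ s t : ℕ, 1 ≤ t → t < s → ∃ (n : ℕ) (G : SimpleGraph (Fin n)),
      2 ≤ n ∧ G.Connected ∧ s ≤ G.strc ∧ G.srvc = t) := by
  refine ⟨⟨fun i => i + 5, blowUpCycle, fun i => ⟨Nat.le_add_left 2 (i + 3), connected_blowUpCycle i,
    strc_blowUpCycle i, src_blowUpCycle i⟩, fun i j hij => ⟨fun φ => hij ?_⟩⟩,
    fun s hs => ?_, fun s t ht hts => ?_⟩
  · have := Fintype.card_congr φ.toEquiv
    simpa using this
  · have : Finite (HubVertex s) := HubVertex.finite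
    have : Nontrivial (HubVertex s) :=
      ⟨.clique ⟨0, by omega⟩, .apex, nofun⟩
    obtain ⟨n, G, hn, hG, h₁, h₂⟩ := exists_fin_of_connected (connected_hubGraph hs)
    exact ⟨n, G, hn, hG, h₁.trans (strc_hubGraph hs), h₂.trans (srvc_hubGraph hs)⟩
  · have : Nontrivial (Fin t ⊕ Fin t × Fin s) :=
      ⟨.inl ⟨0, ht⟩, .inr (⟨0, ht⟩, ⟨0, by omega⟩), by simp⟩
    obtain ⟨n, G, hn, hG, h₁, h₂⟩ :=
      exists_fin_of_connected (connected_pendantClique (s := s) ht)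
    exact ⟨n, G, hn, hG, (le_strc_pendantClique ht).trans h₁.ge,
      h₂.trans (srvc_pendantClique ht (by omega))⟩
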